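/- Let $R$ be a commutative ring with unity. \begin{itemize} \item A $GV$-ideal of $R$ is a finitely generated ideal $J$ such that the natural map $R\to \mathrm{Hom}_R(J,R)$ is an isomorphism. An $R$-module $N$ is $GV$-torsion-free if no nonzero element of $N$ is annihilated by a $GV$-ideal; it is a $w$-module if moreover $\mathrm{Ext}^1_R(R/J,N)=0$ for every $GV$-ideal $J$. A maximal $w$-ideal of $R$ is an ideal that is maximal among the proper ideals of $R$ that are $w$-modules; such ideals are prime. \item A sequence $0\to A\to B\to C\to 0$ of $R$-modules is $w$-exact if $0\to A_{\mathfrak p}\to B_{\mathfrak p}\to C_{\mathfrak p}\to 0$ is exact for every maximal $w$-ideal $\mathfrak p$; it is $w$-pure exact if it is $w$-exact and $0\to A\otimes_R N\to B\otimes_R N\to C\otimes_R N\to 0$ is $w$-exact for every $R$-module $N$. An $R$-module $A$ is absolutely $w$-pure if $0\to A\to B\to B/A\to 0$ is $w$-pure exact for every $R$-module $B$ containing $A$ as a submodule. \item An $R$-module $P$ is $w$-FP-projective if $\mathrm{Ext}^1_R(P,A)=0$ for every absolutely $w$-pure $R$-module $A$. \item The $w$-FP-projective dimension $w\text{-}\mathrm{fpd}_R(M)$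 of an $R$-module $M$ is the smallest integer $k\ge 0$ such that $\mathrm{Ext}^{k+1}_R(M,A)=0$ for every absolutely $w$-pure $R$-module $A$, and $\infty$ if there is no such $k$. \end{itemize} Assume that $R$ is coherent (every finitely generated ideal is finitely presented), let $M$ be an $R$-module and let $n\ge 0$ be an integer. Then the following are equivalent: \begin{enumerate} \item $w\text{-}\mathrm{fpd}_R(M)\le n$. \item $\mathrm{Ext}^{n+1}_R(M,A)=0$ for every absolutely $w$-pure $R$-module $A$. \item $\mathrm{Ext}^{n+j}_R(M,A)=0$ for every absolutely $w$-pure $R$-module $A$ and every $j\ge 1$. \item For every exact sequence $0\to P_n\to P_{n-1}\to\cdots\to P_0\to M\to 0$ of $R$-modules with $P_0,\dots,P_{n-1}$ $w$-FP-projective, $P_n$ is $w$-FP-projective. \item For every exact sequence $0\to P_n\to P_{n-1}\to\cdots\to P_0\to M\to 0$ of $R$-modules with $P_0,\dots,P_{n-1}$ projective, $P_n$ is $w$-FP-projective. \item There exists an exact sequence $0\to P_n\to P_{n-1}\to\cdots\to P_0\to M\to 0$ of $R$-modules with $P_0,\dots,P_n$ all $w$-FP-projective. \end{enumerate} (For $n=0$,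 the equivalence of (2) and (3) says that $M$ is $w$-FP-projective if and only if $\mathrm{Ext}^{j}_R(M,A)=0$ for every absolutely $w$-pure $A$ and every $j\ge1$.) -/

import Mathlib

universe u

namespace WFPProj

open CategoryTheory CategoryTheory.Abelian

section Ring

variable (R : Type u) [CommRing R]

/-- A commutative ring is coherent if every finitely generated ideal is finitely presented. -/
def IsCoherentRing : Prop :=
  ∀ I : Ideal R, I.FG → Module.FinitePresentation R I

/-- `Ext_R^i(M, N) = 0`. -/
def ExtVanishes (M N : Type u) [AddCommGroup M] [Module R M] [AddCommGroup N] [Module R N]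
    (i : ℕ) : Prop :=
  Subsingleton (Ext (ModuleCat.of R M) (ModuleCat.of R N) i)

variable {R}

/-- Glaz-Vasconcelos ideals: `J` is finitely generated and the natural map
`R → Hom_R(J, R)`, sending `r` to multiplication by `r`, is an isomorphism. -/
def IsGVIdeal (J : Ideal R) : Prop :=
  J.FG ∧ Function.Bijective (fun r : R => r • (J.subtype : J →ₗ[R] R))

/-- `M` is `GV`-torsion-free: the only element killed by a `GV`-ideal is `0`. -/
def IsGVTorsionFree (R : Type u) [CommRing R] (M : Type u) [AddCommGroup M] [Module R M] : Prop :=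
  ∀ (x : M) (J : Ideal R), IsGVIdeal J → (∀ r ∈ J, r • x = 0) → x = 0

/-- `M` is a `w`-module: it is `GV`-torsion-free and `Ext_R^1(R/J, M) = 0` for all
`GV`-ideals `J`. -/
def IsWModule (R : Type u) [CommRing R] (M : Type u) [AddCommGroup M] [Module R M] : Prop :=
  IsGVTorsionFree R M ∧ ∀ J : Ideal R, IsGVIdeal J → ExtVanishes R (R ⧸ J) M 1

/-- Maximal `w`-ideals: the maximal elements among the proper ideals that are `w`-modules. -/
def IsMaximalWIdeal (p : Ideal R) : Prop :=
  Maximal (fun I : Ideal R => I ≠ ⊤ ∧ IsWModule R I) p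

lemma extVanishes_one_iff (J : Ideal R) (N : Type u) [AddCommGroup N] [Module R N] :
    ExtVanishes R (R ⧸ J) N 1 ↔ ∀ f : J →ₗ[R] N, ∃ h : R →ₗ[R] N, h ∘ₗ J.subtype = f := by
  let S : ShortComplex (ModuleCat.{u} R) :=
    ShortComplex.mk (ModuleCat.ofHom (J.subtype : J →ₗ[R] R)) (ModuleCat.ofHom J.mkQ)
      (by ext x; exact (Submodule.Quotient.mk_eq_zero J).2 x.2)
  have hS : S.ShortExact :=
    { exact := (ShortComplex.ShortExact.moduleCat_exact_iff_function_exact S).2 (by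
        intro x
        simpa [S] using Ideal.Quotient.eq_zero_iff_mem)
      mono_f := (ModuleCat.mono_iff_injective _).2 J.injective_subtype
      epi_g := (ModuleCat.epi_iff_surjective _).2 J.mkQ_surjective }
  have : Projective S.X₂ := ModuleCat.projective_of_free (Module.Basis.singleton Unit R)
  constructor
  · intro hE f
    let x₁ : Ext S.X₁ (ModuleCat.of R N) 0 := Ext.mk₀ (ModuleCat.ofHom f)
    have h0 : hS.extClass.comp x₁ (add_zero 1) = 0 := hE.elim _ _
    obtain ⟨x₂, hx₂⟩ := Ext.contravariant_sequence_exact₁ hS (ModuleCat.of R N) x₁ (add_zero 1) h0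
    obtain ⟨h, rfl⟩ := (Ext.homEquiv₀ (X := S.X₂) (Y := ModuleCat.of R N)).symm.surjective x₂
    refine ⟨h.hom, ?_⟩
    have h1 : S.f ≫ h = ModuleCat.ofHom f := by
      apply (Ext.mk₀_bijective S.X₁ (ModuleCat.of R N)).1
      rw [← Ext.mk₀_comp_mk₀]
      exact hx₂
    exact congrArg ModuleCat.Hom.hom h1
  · intro H
    refine ⟨fun a b => ?_⟩
    suffices key : ∀ x : Ext S.X₃ (ModuleCat.of R N) 1, x = 0 by
      exact (key a).trans (key b).symm
    intro x
    obtain ⟨x₁, rfl⟩ := Ext.contravariant_sequence_exact₃ hS (ModuleCat.of R N) x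
      (Ext.eq_zero_of_projective _) (add_zero 1)
    obtain ⟨f, rfl⟩ := (Ext.homEquiv₀ (X := S.X₁) (Y := ModuleCat.of R N)).symm.surjective x₁
    obtain ⟨h, hh⟩ := H f.hom
    have hf : f = S.f ≫ ModuleCat.ofHom h := by
      ext1
      exact hh.symm
    have : (Ext.homEquiv₀ (X := S.X₁) (Y := ModuleCat.of R N)).symm f =
        (Ext.mk₀ S.f).comp (Ext.mk₀ (ModuleCat.ofHom h)) (add_zero 0) := by
      rw [Ext.mk₀_comp_mk₀, ← hf]; rfl
    rw [this, ShortComplex.ShortExact.extClass_comp_assoc]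

lemma isGVTorsionFree_ideal (I : Ideal R) : IsGVTorsionFree R I := by
  intro x J hJ h
  have : (fun r : R => r • (J.subtype : J →ₗ[R] R)) (x : R) =
      (fun r : R => r • (J.subtype : J →ₗ[R] R)) 0 := by
    ext ⟨r, hr⟩
    have := congrArg Subtype.val (h r hr)
    simpa [mul_comm] using this
  exact Subtype.ext (hJ.2.1 this)

lemma isWModule_ideal_iff (I : Ideal R) :
    IsWModule R I ↔ ∀ J : Ideal R, IsGVIdeal J → ∀ x : R, (∀ r ∈ J, r * x ∈ I) → x ∈ I := by
  constructor
  · intro hI J hJ x hx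
    obtain ⟨h, hh⟩ := (extVanishes_one_iff J I).1 (hI.2 J hJ)
      (LinearMap.codRestrict I (x • (J.subtype : J →ₗ[R] R))
        (fun r => by simpa [mul_comm] using hx r r.2))
    have hx1 : x = (h 1 : R) := by
      apply hJ.2.1
      ext r
      have h1 := congrArg Subtype.val (LinearMap.congr_fun hh r)
      have h2 : h (r : R) = (r : R) • h 1 := by rw [← map_smul]; simp
      simp only [LinearMap.comp_apply, Submodule.subtype_apply, h2] at h1
      simpa [mul_comm] using h1.symm
    rw [hx1]
    exact (h 1).2
  · intro H
    refine ⟨isGVTorsionFree_ideal I, fun J hJ => (extVanishes_one_iff J I).2 fun f => ?_⟩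
    obtain ⟨x, hx⟩ := hJ.2.2 (I.subtype ∘ₗ f)
    have hxf : ∀ r : J, x * (r : R) = (f r : R) := fun r => LinearMap.congr_fun hx r
    have hxI : x ∈ I := H J hJ x fun r hr => by
      rw [mul_comm, hxf ⟨r, hr⟩]; exact (f _).2
    refine ⟨LinearMap.toSpanSingleton R I ⟨x, hxI⟩, ?_⟩
    ext r
    simpa [mul_comm] using hxf r

/-- Maximal `w`-ideals are prime, so that one can localize at them. -/
lemma IsMaximalWIdeal.isPrime {p : Ideal R} (hp : IsMaximalWIdeal p) : p.IsPrime := by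
  have hw := (isWModule_ideal_iff p).1 hp.1.2
  refine Ideal.isPrime_iff.2 ⟨hp.1.1, fun {a b} hab => ?_⟩
  by_contra! hcon
  let q : Ideal R := Submodule.comap (LinearMap.lsmul R R a) p
  have hmem : ∀ x, x ∈ q ↔ a * x ∈ p := fun x => Iff.rfl
  have hq : q ≠ ⊤ ∧ IsWModule R q := by
    refine ⟨fun h => hcon.1 ?_, (isWModule_ideal_iff q).2 fun J hJ x hx => ?_⟩
    · have : (1 : R) ∈ q := h ▸ Submodule.mem_top
      simpa [hmem] using this
    · refine hw J hJ (a * x) fun r hr => ?_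
      have := (hmem _).1 (hx r hr)
      rwa [mul_left_comm] at this
  have hle : p ≤ q := fun x hx => p.mul_mem_left a hx
  exact hcon.2 (hp.2 hq hle hab)

section Modules

variable {A B C : Type u} [AddCommGroup A] [Module R A] [AddCommGroup B] [Module R B]
  [AddCommGroup C] [Module R C]

/-- `0 → A → B → C → 0` is `w`-exact: for every maximal `w`-ideal `p` (which is automatically
prime) the localized sequence `0 → A_p → B_p → C_p → 0` is exact. -/
def IsWExact (f : A →ₗ[R] B) (g : B →ₗ[R] C) : Prop :=
  ∀ (p : Ideal R) [p.IsPrime], IsMaximalWIdeal p →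
    Function.Injective (LocalizedModule.map p.primeCompl f) ∧
    Function.Exact (LocalizedModule.map p.primeCompl f) (LocalizedModule.map p.primeCompl g) ∧
    Function.Surjective (LocalizedModule.map p.primeCompl g)

/-- `0 → A → B → C → 0` is `w`-pure exact: it is `w`-exact and stays so after tensoring with any
module. -/
def IsWPureExact (f : A →ₗ[R] B) (g : B →ₗ[R] C) : Prop :=
  IsWExact f g ∧
    ∀ (M : Type u) [AddCommGroup M] [Module R M], IsWExact (f.rTensor M) (g.rTensor M)

end Modules

/-- `A` is absolutely `w`-pure: whenever `A` is embedded in a module `B`, the sequence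
`0 → A → B → B/A → 0` is `w`-pure exact. -/
def IsAbsolutelyWPure (R : Type u) [CommRing R] (A : Type u) [AddCommGroup A] [Module R A] :
    Prop :=
  ∀ (B : Type u) [AddCommGroup B] [Module R B] (f : A →ₗ[R] B), Function.Injective f →
    IsWPureExact f (LinearMap.range f).mkQ

/-- `M` is `w`-FP-projective: `Ext_R^1(M, A) = 0` for every absolutely `w`-pure `A`. -/
def IsWFPProjective (R : Type u) [CommRing R] (M : Type u) [AddCommGroup M] [Module R M] : Prop :=
  ∀ (A : Type u) [AddCommGroup A] [Module R A], IsAbsolutelyWPure R A → ExtVanishes R M A 1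

/-- The `w`-FP-projective dimension: the smallest `k ≥ 0` such that `Ext_R^{k+1}(M, A) = 0` for
every absolutely `w`-pure `A`, and `∞` (the infimum of the empty set) if there is none. -/
noncomputable def wfpd (R : Type u) [CommRing R] (M : Type u) [AddCommGroup M] [Module R M] : ℕ∞ :=
  sInf ((fun k : ℕ => (k : ℕ∞)) '' {k : ℕ | ∀ (A : Type u) [AddCommGroup A] [Module R A],
    IsAbsolutelyWPure R A → ExtVanishes R M A (k + 1)})

/-- An exact sequence `0 → P_n → ⋯ → P_1 → P_0 → M → 0` of `R`-modules, stored as an exact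
sequence `⋯ → P_1 → P_0 → M → 0` with `P_i = 0` for `i > n`. -/
structure ExactSeq (R : Type u) [CommRing R] (M : Type u) [AddCommGroup M] [Module R M]
    (n : ℕ) where
  P : ℕ → ModuleCat.{u} R
  d : ∀ i, P (i + 1) →ₗ[R] P i
  ε : P 0 →ₗ[R] M
  surjective : Function.Surjective ε
  exact_zero : Function.Exact (d 0) ε
  exact_succ : ∀ i, Function.Exact (d (i + 1)) (d i)
  subsingleton : ∀ i, n < i → Subsingleton (P i)

end Ring

end WFPProj

namespace WFPProj

open CategoryTheory CategoryTheory.Abelian TensorProduct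

/-! Everything is dimension shifting once vanishing of `Ext` on absolutely `w`-pure modules passes
from degree `i` to `i + 1` (`ExtVanishesOnPure.succ`). Embedding `A` in an injective `E` reduces
this to `IsAbsolutelyWPure.quotient`: `E/A` is again absolutely `w`-pure. For that, purity is read
at each maximal `w`-ideal `p` as an extension property up to a factor `s ∉ p` for maps from finitely
generated `K ⊆ R^n`. Coherence makes such `K` finitely presented; this carries the property from `A`
to `E/A`, and the property in turn gives purity. -/

/-! ### Coherence for submodules of finite free modules. -/

lemma IsCoherentRing.finitePresentation_of_fg {R : Type u} [CommRing R] (hR : IsCoherentRing R) :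
    ∀ (n : ℕ) (K : Submodule R (Fin n → R)), K.FG → Module.FinitePresentation R K
  | 0, K, _ => Module.finitePresentation_of_projective R K
  | n + 1, K, hK => by
    have : Module.Finite R K := Module.Finite.iff_fg.2 hK
    let π : K →ₗ[R] R := LinearMap.proj 0 ∘ₗ K.subtype
    let τ : (Fin (n + 1) → R) →ₗ[R] (Fin n → R) := LinearMap.funLeft R R Fin.succ
    have hI : (LinearMap.range π).FG := Module.Finite.iff_fg.1 inferInstance
    -- The image of the first coordinate is a finitely presented ideal, so its kernel in `K` is
    -- finitely generated; forgetting that coordinate embeds the kernel in `R^n`, where induction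
    -- applies.
    have := hR (LinearMap.range π) hI
    have hker : (LinearMap.ker π).FG := by
      rw [← LinearMap.ker_rangeRestrict]
      exact Module.FinitePresentation.fg_ker _ π.surjective_rangeRestrict
    let φ : LinearMap.ker π →ₗ[R] (Fin n → R) := τ ∘ₗ K.subtype ∘ₗ (LinearMap.ker π).subtype
    have hφ : Function.Injective φ := by
      intro x y hxy
      refine Subtype.ext (Subtype.ext (funext fun i => Fin.cases ?_ (fun i => ?_) i))
      · exact (LinearMap.mem_ker.1 x.2).trans (LinearMap.mem_ker.1 y.2).symm
      · exact congrFun hxy i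
    have : Module.Finite R (LinearMap.ker π) := Module.Finite.iff_fg.2 hker
    have := hR.finitePresentation_of_fg n (LinearMap.range φ)
      (Module.Finite.iff_fg.1 inferInstance)
    have := Module.FinitePresentation.of_equiv (R := R) (M := LinearMap.range φ)
      (N := LinearMap.ker π) (LinearEquiv.ofInjective φ hφ).symm
    rw [← LinearMap.ker_rangeRestrict] at this
    exact Module.finitePresentation_of_ker π.rangeRestrict π.surjective_rangeRestrict

/-! ### Elementwise criterion for `w`-exactness. -/

section Localization

variable {R : Type u} [CommRing R] {A B C : Type u} [AddCommGroup A] [Module R A] [AddCommGroup B]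
  [Module R B] [AddCommGroup C] [Module R C]

lemma localizedModule_map_injective_iff (S : Submonoid R) (f : A →ₗ[R] B) :
    Function.Injective (LocalizedModule.map S f) ↔ ∀ x, f x = 0 → ∃ s ∈ S, s • x = 0 := by
  rw [injective_iff_map_eq_zero]
  constructor
  · intro h x hx
    have h0 := h (LocalizedModule.mk x 1) (by
      rw [LocalizedModule.map_mk, hx, LocalizedModule.zero_mk])
    rw [← LocalizedModule.zero_mk 1, LocalizedModule.mk_eq] at h0
    obtain ⟨s, hs⟩ := h0
    exact ⟨s, s.2, by simpa using! hs⟩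
  · intro h x
    induction x with
    | _ m t =>
      intro hx
      rw [LocalizedModule.map_mk, ← LocalizedModule.zero_mk 1, LocalizedModule.mk_eq] at hx
      obtain ⟨s, hs⟩ := hx
      obtain ⟨s', hs', h0⟩ := h ((s : R) • m) (by
        rw [map_smul]; simpa using! hs)
      rw [← LocalizedModule.zero_mk 1, LocalizedModule.mk_eq]
      refine ⟨⟨s', hs'⟩ * s, ?_⟩
      rw [one_smul, smul_zero, smul_zero, mul_smul]
      exact h0

/-- Localization preserves right exactness, so only injectivity on the left has to be tested. -/
lemma IsWExact.of_exact {f : A →ₗ[R] B} {g : B →ₗ[R] C} (hfg : Function.Exact f g)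
    (hg : Function.Surjective g)
    (hf : ∀ (p : Ideal R) [p.IsPrime], IsMaximalWIdeal p → ∀ x, f x = 0 → ∃ s ∈ p.primeCompl,
      s • x = 0) : IsWExact f g := fun p _ hp =>
  ⟨(localizedModule_map_injective_iff _ f).2 (hf p hp),
    LocalizedModule.map_exact p.primeCompl f g hfg,
    IsLocalizedModule.map_surjective p.primeCompl _ _ g hg⟩

end Localization

/-! ### Vanishing of elements in tensor products. -/

lemma exists_sum_tmul_of_span_eq_top {R N Q ι : Type*} [CommRing R] [AddCommGroup N] [Module R N]
    [AddCommGroup Q] [Module R Q] [Fintype ι] {v : ι → N} (hv : Submodule.span R (Set.range v) = ⊤)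
    (x : N ⊗[R] Q) : ∃ q : ι → Q, x = ∑ i, v i ⊗ₜ q i := by
  induction x with
  | zero => exact ⟨0, by simp⟩
  | add x y hx hy =>
    obtain ⟨q, rfl⟩ := hx
    obtain ⟨q', rfl⟩ := hy
    exact ⟨q + q', by simp [tmul_add, Finset.sum_add_distrib]⟩
  | tmul n q =>
    obtain ⟨c, rfl⟩ := (Submodule.mem_span_range_iff_exists_fun R).1
      (hv ▸ Submodule.mem_top : n ∈ Submodule.span R (Set.range v))
    exact ⟨fun i => c i • q, by simp [sum_tmul, smul_tmul]⟩

/-- An element of the kernel of `N ⊗ Q → N ⊗ B` comes from relations witnessing that it vanishes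
trivially in `N ⊗ B`. -/
lemma exists_relations_of_lTensor_eq_zero {R : Type u} {N Q B : Type u} [CommRing R]
    [AddCommGroup N] [Module R N] [AddCommGroup Q] [Module R Q] [AddCommGroup B] [Module R B]
    (f : Q →ₗ[R] B) (x : N ⊗[R] Q) (hx : f.lTensor N x = 0) :
    ∃ (m k : ℕ) (v : Fin m → N) (q : Fin m → Q) (a : Fin m → Fin k → R) (y : Fin k → B),
      x = ∑ i, v i ⊗ₜ q i ∧ (∀ i, f (q i) = ∑ j, a i j • y j) ∧ ∀ j, ∑ i, a i j • v i = 0 := by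
  -- The equational criterion needs a generating family, so `N` is cut down to a finitely generated
  -- `N₂` over which the image of `x` already vanishes.
  obtain ⟨N₁, hN₁, x₁, rfl⟩ := Submodule.exists_fg_le_eq_rTensor_subtype x
  have h0 : N₁.subtype.rTensor B (f.lTensor N₁ x₁) = N₁.subtype.rTensor B 0 := by
    rw [map_zero, ← hx, ← LinearMap.comp_apply, ← LinearMap.comp_apply,
      LinearMap.rTensor_comp_lTensor, LinearMap.lTensor_comp_rTensor]
  obtain ⟨N₂, hN₂, hle, h2⟩ := hN₁.exists_rTensor_fg_inclusion_eq h0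
  have : Module.Finite R N₂ := Module.Finite.iff_fg.2 hN₂
  obtain ⟨m, v, hv⟩ := Module.Finite.exists_fin (R := R) (M := N₂)
  obtain ⟨q, hq⟩ := exists_sum_tmul_of_span_eq_top hv ((N₁.inclusion hle).rTensor Q x₁)
  have hz : ∑ i, v i ⊗ₜ[R] f (q i) = 0 := by
    have : f.lTensor N₂ ((N₁.inclusion hle).rTensor Q x₁) = 0 := by
      rw [← map_zero ((N₁.inclusion hle).rTensor B), ← h2, ← LinearMap.comp_apply,
        ← LinearMap.comp_apply, LinearMap.rTensor_comp_lTensor, LinearMap.lTensor_comp_rTensor]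
    simpa [hq] using this
  obtain ⟨k, a, y, h3, h4⟩ := TensorProduct.vanishesTrivially_of_sum_tmul_eq_zero R hv hz
  refine ⟨m, k, fun i => v i, q, a, y, ?_, h3, fun j => ?_⟩
  · have : N₁.subtype.rTensor Q x₁ =
        N₂.subtype.rTensor Q ((N₁.inclusion hle).rTensor Q x₁) := by
      rw [← LinearMap.rTensor_comp_apply]; rfl
    rw [this, hq]
    simp
  · simpa using congrArg Subtype.val (h4 j)

/-! ### Absolute `w`-purity via linear systems and extension of maps. -/

section AbsolutelyPure

variable {R : Type u} [CommRing R] {A E : Type u} [AddCommGroup A] [Module R A] [AddCommGroup E]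
  [Module R E]

/-- Tensor `ι` with `R^m/W`, where `W` is spanned by the columns of `a`. Solvability in `E` makes `∑
x i ⊗ v i` vanish there, so purity kills it in `A ⊗ R^m/W` up to some `s ∉ p`; the equational
criterion then yields a solution. -/
lemma IsAbsolutelyWPure.exists_smul_eq (hA : IsAbsolutelyWPure R A) (ι : A →ₗ[R] E)
    (hι : Function.Injective ι) (p : Ideal R) [p.IsPrime] (hp : IsMaximalWIdeal p) {m n : ℕ}
    (a : Fin m → Fin n → R) (x : Fin m → A) (e : Fin n → E)
    (he : ∀ i, ι (x i) = ∑ j, a i j • e j) :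
    ∃ s ∈ p.primeCompl, ∃ y : Fin n → A, ∀ i, s • x i = ∑ j, a i j • y j := by
  let W : Submodule R (Fin m → R) := Submodule.span R (Set.range fun j i => a i j)
  let v : Fin m → (Fin m → R) ⧸ W := fun i => W.mkQ (Pi.single i 1)
  have hlin (c : Fin m → R) : ∑ i, c i • v i = W.mkQ c := by
    simp only [v, ← map_smul, ← map_sum]
    congr 1
    exact (pi_eq_sum_univ' c).symm
  have hv : Submodule.span R (Set.range v) = ⊤ := by
    refine eq_top_iff.2 fun z _ => ?_
    obtain ⟨c, rfl⟩ := W.mkQ_surjective z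
    rw [← hlin]
    exact Submodule.sum_mem _ fun i _ => Submodule.smul_mem _ _ (Submodule.subset_span ⟨i, rfl⟩)
  have hva (j : Fin n) : ∑ i, a i j • v i = 0 := by
    rw [hlin fun i => a i j]
    exact (Submodule.Quotient.mk_eq_zero W).2 (Submodule.subset_span ⟨j, rfl⟩)
  have hzero : ι.rTensor ((Fin m → R) ⧸ W) (∑ i, x i ⊗ₜ v i) = 0 := by
    simp only [map_sum, LinearMap.rTensor_tmul, he, sum_tmul]
    rw [Finset.sum_comm]
    refine Finset.sum_eq_zero fun j _ => ?_
    simp only [smul_tmul, ← tmul_sum, hva, tmul_zero]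
  obtain ⟨s, hs, h0⟩ := (localizedModule_map_injective_iff _ _).1
    (((hA E ι hι).2 ((Fin m → R) ⧸ W)) p hp).1 _ hzero
  have h1 : ∑ i, v i ⊗ₜ[R] (s • x i) = 0 := by
    have := congrArg (TensorProduct.comm R A ((Fin m → R) ⧸ W)) h0
    rw [map_smul, map_zero, map_sum, Finset.smul_sum] at this
    simpa only [TensorProduct.comm_tmul, ← tmul_smul] using this
  obtain ⟨k, c, y, h2, h3⟩ := TensorProduct.vanishesTrivially_of_sum_tmul_eq_zero R hv h1
  -- Each relation among the `v i` lies in `W`, hence is a combination of columns of `a`.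
  have h4 (l : Fin k) : ∃ d : Fin n → R, ∑ j, d j • (fun i => a i j) = fun i => c i l := by
    refine (Submodule.mem_span_range_iff_exists_fun R).1 ?_
    rw [← Submodule.Quotient.mk_eq_zero]
    exact (hlin fun i => c i l).symm.trans (h3 l)
  choose d hd using h4
  refine ⟨s, hs, fun j => ∑ l, d l j • y l, fun i => (h2 i).trans ?_⟩
  simp only [Finset.smul_sum]
  rw [Finset.sum_comm]
  refine Finset.sum_congr rfl fun l _ => ?_
  have := congrFun (hd l) i
  simp only [Finset.sum_apply, Pi.smul_apply, smul_eq_mul] at this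
  rw [← this, Finset.sum_smul]
  exact Finset.sum_congr rfl fun j _ => by rw [smul_smul, mul_comm]

/-- The linear system has the coordinates of generators of `K` as coefficients; `g` on the standard
basis solves it in `E`. -/
lemma IsAbsolutelyWPure.exists_extension (hA : IsAbsolutelyWPure R A) (ι : A →ₗ[R] E)
    (hι : Function.Injective ι) (p : Ideal R) [p.IsPrime] (hp : IsMaximalWIdeal p) {n : ℕ}
    (K : Submodule R (Fin n → R)) (hK : K.FG) (f : K →ₗ[R] A) (g : (Fin n → R) →ₗ[R] E)
    (hfg : ∀ x : K, g x = ι (f x)) :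
    ∃ s ∈ p.primeCompl, ∃ h : (Fin n → R) →ₗ[R] A, ∀ x : K, h x = s • f x := by
  have : Module.Finite R K := Module.Finite.iff_fg.2 hK
  obtain ⟨m, k, hk⟩ := Module.Finite.exists_fin (R := R) (M := K)
  obtain ⟨s, hs, y, hy⟩ := hA.exists_smul_eq ι hι p hp (fun i j => (k i : Fin n → R) j)
    (fun i => f (k i)) (fun j => g (Pi.single j 1)) (fun i => by
      rw [← hfg]
      conv_lhs => rw [pi_eq_sum_univ' (k i : Fin n → R)]
      simp only [map_sum, map_smul])
  refine ⟨s, hs, Fintype.linearCombination R y, fun x => ?_⟩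
  refine LinearMap.congr_fun (f := Fintype.linearCombination R y ∘ₗ K.subtype) (g := s • f) ?_ x
  refine LinearMap.ext_on_range hk fun i => ?_
  simp [Fintype.linearCombination_apply, hy]

/-- Over a coherent ring, the cokernel of an absolutely `w`-pure submodule of an injective module
is absolutely `w`-pure. -/
theorem IsAbsolutelyWPure.quotient (hR : IsCoherentRing R) (hA : IsAbsolutelyWPure R A)
    [Module.Injective R E] {Q : Type u} [AddCommGroup Q] [Module R Q] (ι : A →ₗ[R] E)
    (π : E →ₗ[R] Q) (hι : Function.Injective ι) (hιπ : Function.Exact ι π)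
    (hπ : Function.Surjective π) : IsAbsolutelyWPure R Q := by
  -- The local extension property for `Q`, from which purity of every embedding of `Q` follows.
  have key : ∀ (p : Ideal R) [p.IsPrime], IsMaximalWIdeal p → ∀ {n : ℕ}
      (K : Submodule R (Fin n → R)), K.FG → ∀ f : K →ₗ[R] Q,
      ∃ s ∈ p.primeCompl, ∃ h : (Fin n → R) →ₗ[R] Q, ∀ x : K, h x = s • f x := by
    intro p _ hp n K hK f
    have := hR.finitePresentation_of_fg n K hK
    obtain ⟨k, r, hr⟩ := Module.Finite.exists_fin' R K
    have hL : (LinearMap.ker r).FG := Module.FinitePresentation.fg_ker r hr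
    obtain ⟨g, hg⟩ := Module.projective_lifting_property π (f ∘ₗ r) hπ
    have hgL (x : LinearMap.ker r) : g x ∈ LinearMap.range ι := by
      refine (hιπ _).1 ?_
      rw [← LinearMap.comp_apply, hg]
      simp
    let eA := LinearEquiv.ofInjective ι hι
    let g₀ : LinearMap.ker r →ₗ[R] A :=
      eA.symm.toLinearMap ∘ₗ (g ∘ₗ (LinearMap.ker r).subtype).codRestrict _ hgL
    have hg₀ (x : LinearMap.ker r) : g x = ι (g₀ x) :=
      (congrArg Subtype.val (eA.apply_symm_apply ⟨g x, hgL x⟩)).symm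
    obtain ⟨s, hs, h, hh⟩ := hA.exists_extension ι hι p hp (LinearMap.ker r) hL g₀ g hg₀
    -- The correction by `h` makes `s • g` vanish on the relations of `K`, so it descends to `K → E`
    -- and extends to `R^n` by injectivity; `π` erases the correction.
    let ψ : (Fin k → R) →ₗ[R] E := s • g - ι ∘ₗ h
    have hψ : LinearMap.ker r ≤ LinearMap.ker ψ := by
      intro x hx
      simp [ψ, hh ⟨x, hx⟩, hg₀ ⟨x, hx⟩]
    let φ : K →ₗ[R] E := (LinearMap.ker r).liftQ ψ hψ ∘ₗ
      (r.quotKerEquivOfSurjective hr).symm.toLinearMap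
    have hφ (z : Fin k → R) : φ (r z) = ψ z := by
      have : (r.quotKerEquivOfSurjective hr).symm (r z) = Submodule.Quotient.mk z := by
        rw [LinearEquiv.symm_apply_eq]; rfl
      simp [φ, this]
    obtain ⟨Φ, hΦ⟩ := Module.Injective.extension_property R E K (Fin n → R) K.subtype
      K.injective_subtype φ
    refine ⟨s, hs, π ∘ₗ Φ, fun x => ?_⟩
    obtain ⟨z, rfl⟩ := hr x
    have h1 : Φ (r z : Fin n → R) = ψ z := (LinearMap.congr_fun hΦ (r z)).trans (hφ z)
    have h2 : π (g z) = f (r z) := LinearMap.congr_fun hg z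
    simp [h1, ψ, h2, hιπ.apply_apply_eq_zero]
  intro B _ _ f hf
  have hex : Function.Exact f (LinearMap.range f).mkQ := LinearMap.exact_map_mkQ_range f
  have hsurj := (LinearMap.range f).mkQ_surjective
  refine ⟨IsWExact.of_exact hex hsurj fun p _ _ x hx => ⟨1, one_mem _, ?_⟩, fun N _ _ =>
    IsWExact.of_exact (rTensor_exact N hex hsurj) (LinearMap.rTensor_surjective N hsurj)
      fun p _ hp x hx => ?_⟩
  · rw [one_smul]
    exact (injective_iff_map_eq_zero f).1 hf x hx
  · have hx' : f.lTensor N (TensorProduct.comm R Q N x) = 0 := by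
      rw [← LinearMap.comm_comp_rTensor_comp_comm_eq]
      simp [hx]
    obtain ⟨m, k, v, q, a, y, hxs, hq, hv⟩ := exists_relations_of_lTensor_eq_zero f _ hx'
    -- The rows of `a` span `K`, and `F` sends row `i` to `q i`. Extending `s • F` to `R^k` moves
    -- the solution `y` from `B` into `Q`, up to `s`.
    let K : Submodule R (Fin k → R) := Submodule.span R (Set.range a)
    have hK : K.FG := Submodule.fg_span (Set.finite_range a)
    let Y : (Fin k → R) →ₗ[R] B := Fintype.linearCombination R y
    have hY (i : Fin m) : Y (a i) = f (q i) := by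
      rw [hq]; rfl
    have hYK : K ≤ (LinearMap.range f).comap Y := by
      refine Submodule.span_le.2 ?_
      rintro _ ⟨i, rfl⟩
      exact ⟨q i, (hY i).symm⟩
    let eQ := LinearEquiv.ofInjective f hf
    let F : K →ₗ[R] Q := eQ.symm.toLinearMap ∘ₗ
      (Y ∘ₗ K.subtype).codRestrict _ fun x => hYK x.2
    have haK (i : Fin m) : a i ∈ K := Submodule.subset_span ⟨i, rfl⟩
    have hF (i : Fin m) : F ⟨a i, haK i⟩ = q i := by
      refine (LinearEquiv.symm_apply_eq eQ).2 (Subtype.ext ?_)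
      exact hY i
    obtain ⟨s, hs, h, hh⟩ := key p hp K hK F
    refine ⟨s, hs, (TensorProduct.comm R Q N).injective ?_⟩
    rw [map_zero, map_smul, hxs]
    have hsq (i : Fin m) : s • q i = ∑ j, a i j • h (Pi.single j 1) := by
      rw [← hF, ← hh ⟨a i, haK i⟩]
      refine (congrArg h (pi_eq_sum_univ' (a i))).trans ?_
      simp only [map_sum, map_smul]
    simp only [Finset.smul_sum, ← tmul_smul, hsq, tmul_sum]
    rw [Finset.sum_comm]
    refine Finset.sum_eq_zero fun j _ => ?_
    simp only [← smul_tmul, ← sum_tmul, hv, zero_tmul]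

end AbsolutelyPure

/-! ### Dimension shifting for `Ext`. -/

section Shifting

variable {R : Type u} [CommRing R] {A B C : Type u} [AddCommGroup A] [Module R A] [AddCommGroup B]
  [Module R B] [AddCommGroup C] [Module R C] {f : A →ₗ[R] B} {g : B →ₗ[R] C}

lemma shortExact_of_exact (hf : Function.Injective f) (hfg : Function.Exact f g)
    (hg : Function.Surjective g) :
    (ShortComplex.mk (ModuleCat.ofHom f) (ModuleCat.ofHom g)
      (by ext1; exact hfg.linearMap_comp_eq_zero)).ShortExact where
  exact := (ShortComplex.ShortExact.moduleCat_exact_iff_function_exact _).2 hfg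
  mono_f := (ModuleCat.mono_iff_injective _).2 hf
  epi_g := (ModuleCat.epi_iff_surjective _).2 hg

lemma extVanishes_iff_forall_eq_zero {i : ℕ} :
    ExtVanishes R A B i ↔ ∀ x : Ext (ModuleCat.of R A) (ModuleCat.of R B) i, x = 0 :=
  ⟨fun h _ => h.elim _ _, fun h => ⟨fun a b => (h a).trans (h b).symm⟩⟩

lemma extVanishes_of_projective [Module.Projective R A] (i : ℕ) : ExtVanishes R A B (i + 1) :=
  Ext.subsingleton_of_projective _ _ i

lemma ExtVanishes.congr_left (e : A ≃ₗ[R] B) {i : ℕ} (h : ExtVanishes R A C i) :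
    ExtVanishes R B C i := by
  rw [extVanishes_iff_forall_eq_zero] at h ⊢
  intro x
  have h0 := h ((Ext.mk₀ e.toModuleIso.hom).comp x (zero_add i))
  have h1 : (Ext.mk₀ e.toModuleIso.inv).comp ((Ext.mk₀ e.toModuleIso.hom).comp x (zero_add i))
      (zero_add i) = x := by
    rw [Ext.mk₀_comp_mk₀_assoc, Iso.inv_hom_id, Ext.mk₀_id_comp]
  rw [← h1, h0, Ext.comp_zero]

variable (N : Type u) [AddCommGroup N] [Module R N]

lemma ExtVanishes.of_first_of_second (hf : Function.Injective f) (hfg : Function.Exact f g)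
    (hg : Function.Surjective g) {i : ℕ} (hA : ExtVanishes R A N i)
    (hB : ExtVanishes R B N (i + 1)) : ExtVanishes R C N (i + 1) := by
  rw [extVanishes_iff_forall_eq_zero] at *
  intro x
  have hS := shortExact_of_exact hf hfg hg
  obtain ⟨y, rfl⟩ := Ext.contravariant_sequence_exact₃ hS (ModuleCat.of R N) x (hB _)
    (add_comm 1 i)
  rw [hA y, Ext.comp_zero]

lemma ExtVanishes.of_second_of_third (hf : Function.Injective f) (hfg : Function.Exact f g)
    (hg : Function.Surjective g) {i : ℕ} (hB : ExtVanishes R B N i)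
    (hC : ExtVanishes R C N (i + 1)) : ExtVanishes R A N i := by
  rw [extVanishes_iff_forall_eq_zero] at *
  intro x
  have hS := shortExact_of_exact hf hfg hg
  obtain ⟨y, rfl⟩ := Ext.contravariant_sequence_exact₁ hS (ModuleCat.of R N) x (add_comm 1 i) (hC _)
  rw [hB y, Ext.comp_zero]

lemma ExtVanishes.of_cokernel_injective (hf : Function.Injective f) (hfg : Function.Exact f g)
    (hg : Function.Surjective g) [Module.Injective R B] {i : ℕ} (hC : ExtVanishes R N C i) :
    ExtVanishes R N A (i + 1) := by
  rw [extVanishes_iff_forall_eq_zero] at *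
  intro x
  have hS := shortExact_of_exact hf hfg hg
  have : Injective (ModuleCat.of R B) := Module.injective_object_of_injective_module R B
  obtain ⟨y, rfl⟩ := Ext.covariant_sequence_exact₁ (ModuleCat.of R N) hS x
    (Ext.eq_zero_of_injective _) rfl
  rw [hC y, Ext.zero_comp]

end Shifting

/-! ### The dimension and exact sequences. -/

section Dimension

variable {R : Type u} [CommRing R]

/-- `Ext_R^i(M, A) = 0` for every absolutely `w`-pure module `A`. -/
def ExtVanishesOnPure (R : Type u) [CommRing R] (M : Type u) [AddCommGroup M] [Module R M]
    (i : ℕ) : Prop :=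
  ∀ (A : Type u) [AddCommGroup A] [Module R A], IsAbsolutelyWPure R A → ExtVanishes R M A i

variable {M : Type u} [AddCommGroup M] [Module R M]

/-- Shift in the second variable: `Ext^i(M, E/A)` surjects onto `Ext^(i+1)(M, A)` for `E` injective.
-/
lemma ExtVanishesOnPure.succ (hR : IsCoherentRing R) {i : ℕ} (h : ExtVanishesOnPure R M i) :
    ExtVanishesOnPure R M (i + 1) := by
  intro A _ _ hA
  let E := Injective.under (ModuleCat.of R A)
  let ι : A →ₗ[R] E := (Injective.ι (ModuleCat.of R A)).hom
  have hι : Function.Injective ι := (ModuleCat.mono_iff_injective _).1 inferInstance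
  have : Injective (ModuleCat.of R E) := inferInstanceAs (Injective E)
  have : Module.Injective R E := Module.injective_module_of_injective_object R E
  have hex : Function.Exact ι (LinearMap.range ι).mkQ := LinearMap.exact_map_mkQ_range ι
  have hsurj := (LinearMap.range ι).mkQ_surjective
  exact ExtVanishes.of_cokernel_injective M hι hex hsurj
    (h _ (hA.quotient hR ι _ hι hex hsurj))

lemma ExtVanishesOnPure.mono (hR : IsCoherentRing R) {i j : ℕ} (hij : i ≤ j)
    (h : ExtVanishesOnPure R M i) : ExtVanishesOnPure R M j := by
  induction j, hij using Nat.le_induction with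
  | base => exact h
  | succ j _ ih => exact ih.succ hR

lemma wfpd_le_iff (hR : IsCoherentRing R) (n : ℕ) :
    wfpd R M ≤ (n : ℕ∞) ↔ ExtVanishesOnPure R M (n + 1) := by
  constructor
  · intro h
    -- An empty set would give infimum `⊤`, so the infimum is attained at some `k ≤ n`.
    have hne : ((fun k : ℕ => (k : ℕ∞)) '' {k : ℕ | ExtVanishesOnPure R M (k + 1)}).Nonempty := by
      rw [Set.nonempty_iff_ne_empty]
      intro h0
      have : wfpd R M = ⊤ := (congrArg sInf h0).trans sInf_empty
      rw [this] at h
      exact ENat.natCast_ne_top n (top_le_iff.1 h)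
    obtain ⟨k, hk, hk'⟩ := csInf_mem hne
    have hkn : (k : ℕ∞) ≤ n := hk'.le.trans h
    exact ExtVanishesOnPure.mono hR (Nat.succ_le_succ (by exact_mod_cast hkn)) hk
  · intro h
    exact sInf_le ⟨n, h, rfl⟩

/-- Dropping the first term of an exact sequence. -/
def ExactSeq.tail {n : ℕ} (S : ExactSeq R M (n + 1)) : ExactSeq R (LinearMap.ker S.ε) n where
  P i := S.P (i + 1)
  d i := S.d (i + 1)
  ε := (S.d 0).codRestrict _ fun x => S.exact_zero.apply_apply_eq_zero x
  surjective x := by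
    obtain ⟨y, hy⟩ := (S.exact_zero x).1 x.2
    exact ⟨y, Subtype.ext hy⟩
  exact_zero x := by
    rw [← S.exact_succ 0 x]
    exact Subtype.ext_iff
  exact_succ i := S.exact_succ (i + 1)
  subsingleton i hi := S.subsingleton (i + 1) (Nat.succ_lt_succ hi)

/-- The modules of an exact sequence extended by one term. -/
def consObj (P : ModuleCat.{u} R) (Q : ℕ → ModuleCat.{u} R) : ℕ → ModuleCat.{u} R
  | 0 => P
  | i + 1 => Q i

/-- Splicing an exact sequence of the kernel of a surjection `P → M` with that surjection. -/
def ExactSeq.cons {n : ℕ} (P : ModuleCat.{u} R) (π : P →ₗ[R] M) (hπ : Function.Surjective π)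
    (S : ExactSeq R (LinearMap.ker π) n) : ExactSeq R M (n + 1) where
  P := consObj P S.P
  d
    | 0 => (LinearMap.ker π).subtype ∘ₗ S.ε
    | i + 1 => S.d i
  ε := π
  surjective := hπ
  exact_zero x := by
    constructor
    · intro hx
      obtain ⟨y, hy⟩ := S.surjective ⟨x, hx⟩
      exact ⟨y, congrArg Subtype.val hy⟩
    · rintro ⟨y, rfl⟩
      exact (S.ε y).2
  exact_succ
    | 0 => fun x => (Subtype.ext_iff (a1 := S.ε x) (a2 := 0)).symm.trans (S.exact_zero x)
    | i + 1 => S.exact_succ i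
  subsingleton
    | 0, h => absurd h (Nat.not_lt_zero _)
    | i + 1, h => S.subsingleton i (Nat.lt_of_succ_lt_succ h)

/-- The exact sequence `0 → M → M → 0`. -/
def ExactSeq.self (R M : Type u) [CommRing R] [AddCommGroup M] [Module R M] : ExactSeq R M 0 where
  P := consObj (ModuleCat.of R M) fun _ => ModuleCat.of R PUnit
  d _ := 0
  ε := LinearMap.id (M := M)
  surjective := Function.surjective_id
  exact_zero _ := ⟨fun hx => ⟨0, hx.symm⟩, fun ⟨_, hy⟩ => hy.symm⟩
  exact_succ _ _ := ⟨fun _ => ⟨0, Subsingleton.elim (α := PUnit) _ _⟩, fun _ => rfl⟩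
  subsingleton
    | 0, h => absurd h (Nat.not_lt_zero _)
    | _ + 1, _ => inferInstanceAs (Subsingleton PUnit)

lemma exists_exactSeq_projective (R : Type u) [CommRing R] (n : ℕ) :
    ∀ (M : Type u) [AddCommGroup M] [Module R M],
      ∃ S : ExactSeq R M n, ∀ i < n, Module.Projective R (S.P i) := by
  induction n with
  | zero => exact fun M _ _ => ⟨ExactSeq.self R M, fun i hi => absurd hi (Nat.not_lt_zero i)⟩
  | succ n ih =>
    intro M _ _
    let π : (M →₀ R) →ₗ[R] M := Finsupp.linearCombination R id
    have hπ : Function.Surjective π := Finsupp.linearCombination_id_surjective R M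
    obtain ⟨S, hS⟩ := ih (LinearMap.ker π)
    refine ⟨ExactSeq.cons (ModuleCat.of R (M →₀ R)) π hπ S, fun i hi => ?_⟩
    cases i with
    | zero => exact inferInstanceAs (Module.Projective R (M →₀ R))
    | succ i => exact hS i (Nat.lt_of_succ_lt_succ hi)

/-- Replace `M` by `ker ε`: all positive `Ext` of `P 0` into absolutely `w`-pure modules vanish, so
the conditions on `M` and on `ker ε` differ by one degree. -/
lemma extVanishesOnPure_iff_exactSeq (hR : IsCoherentRing R) (n : ℕ) :
    ∀ {M : Type u} [AddCommGroup M] [Module R M] (S : ExactSeq R M n),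
      (∀ i < n, IsWFPProjective R (S.P i)) →
      (ExtVanishesOnPure R M (n + 1) ↔ IsWFPProjective R (S.P n)) := by
  induction n with
  | zero =>
    intro M _ _ S _
    -- For `n = 0` the term `P 1` is zero, so `ε` is an isomorphism.
    have := S.subsingleton 1 zero_lt_one
    have hinj : Function.Injective S.ε := by
      refine (injective_iff_map_eq_zero S.ε).2 fun x hx => ?_
      obtain ⟨y, rfl⟩ := (S.exact_zero x).1 hx
      rw [Subsingleton.elim y 0, map_zero]
    let e : S.P 0 ≃ₗ[R] M := LinearEquiv.ofBijective S.ε ⟨hinj, S.surjective⟩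
    exact ⟨fun h A _ _ hA => (h A hA).congr_left e.symm, fun h A _ _ hA => (h A hA).congr_left e⟩
  | succ n ih =>
    intro M _ _ S hS
    rw [← show IsWFPProjective R (S.tail.P n) ↔ IsWFPProjective R (S.P (n + 1)) from Iff.rfl,
      ← ih S.tail fun i hi => hS (i + 1) (Nat.succ_lt_succ hi)]
    have h0 : ExtVanishesOnPure R (S.P 0) 1 := hS 0 n.succ_pos
    have hinj := (LinearMap.ker S.ε).injective_subtype
    have hex := LinearMap.exact_subtype_ker_map S.ε
    exact ⟨fun h A _ _ hA => ExtVanishes.of_second_of_third A hinj hex S.surjective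
        (h0.mono hR (Nat.le_add_left 1 n) A hA) (h A hA),
      fun h A _ _ hA => ExtVanishes.of_first_of_second A hinj hex S.surjective (h A hA)
        (h0.mono hR (Nat.le_add_left 1 (n + 1)) A hA)⟩

end Dimension

end WFPProj

theorem mainTheorem7 {R : Type u} [CommRing R] (hR : WFPProj.IsCoherentRing R)
    (M : Type u) [AddCommGroup M] [Module R M] (n : ℕ) :
    List.TFAE [
      WFPProj.wfpd R M ≤ (n : ℕ∞),
      ∀ (A : Type u) [AddCommGroup A] [Module R A], WFPProj.IsAbsolutelyWPure R A →
        WFPProj.ExtVanishes R M A (n + 1),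
      ∀ (A : Type u) [AddCommGroup A] [Module R A], WFPProj.IsAbsolutelyWPure R A →
        ∀ j : ℕ, 1 ≤ j → WFPProj.ExtVanishes R M A (n + j),
      ∀ S : WFPProj.ExactSeq R M n, (∀ i < n, WFPProj.IsWFPProjective R (S.P i)) →
        WFPProj.IsWFPProjective R (S.P n),
      ∀ S : WFPProj.ExactSeq R M n, (∀ i < n, Module.Projective R (S.P i)) →
        WFPProj.IsWFPProjective R (S.P n),
      ∃ S : WFPProj.ExactSeq R M n, ∀ i ≤ n, WFPProj.IsWFPProjective R (S.P i)] := by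
  have hproj : ∀ (P : ModuleCat.{u} R), Module.Projective R P → WFPProj.IsWFPProjective R P :=
    fun P _ A _ _ _ => WFPProj.extVanishes_of_projective 0
  tfae_have 1 ↔ 2 := WFPProj.wfpd_le_iff hR n
  tfae_have 2 → 3 := fun h A _ _ hA j hj =>
    WFPProj.ExtVanishesOnPure.mono hR (Nat.add_le_add_left hj n) h A hA
  tfae_have 3 → 4 := fun h S hS => (WFPProj.extVanishesOnPure_iff_exactSeq hR n S hS).1
    fun A _ _ hA => h A hA 1 le_rfl
  tfae_have 4 → 5 := fun h S hS => h S fun i hi => hproj _ (hS i hi)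
  tfae_have 5 → 6 := fun h => by
    obtain ⟨S, hS⟩ := WFPProj.exists_exactSeq_projective R n M
    refine ⟨S, fun i hi => ?_⟩
    rcases hi.lt_or_eq with hi | rfl
    · exact hproj _ (hS i hi)
    · exact h S hS
  tfae_have 6 → 2 := fun ⟨S, hS⟩ =>
    (WFPProj.extVanishesOnPure_iff_exactSeq hR n S fun i hi => hS i hi.le).2 (hS n le_rfl)
  tfae_finish
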